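/- Let $P$ be a simple polygon in the Euclidean plane, i.e. the closed bounded region enclosed by a simple closed polygonal chain with $n\ge 3$ distinct vertices $v_1,\dots,v_n$ (consecutive edges meet only in their common vertex, non-consecutive edges are disjoint). Two points $x,y$ are *visible* to each other if the segment $xy$ is contained in $P$. A set $G$ of vertices *covers* a set $A\subseteq P$ if every point of $A$ is visible from some vertex in $G$. A *visibility region* is a maximal connected subset $R$ of $P$ all of whose points are visible from the same set of vertices; this set of vertices is its *visibility set* $M_R$. Two different visibility regions $R,Q$ are *neighbouring* if they share an edge, i.e. if there is a nondegenerate segment that is contained in the boundary of $R$ and in the boundary of $Q$ and whose points belong to $R\cup Q$ (so that no third visibility region separates them along it). A *VG-sink* is a visibility region $s$ with nonempty interior such that $M_s\subseteq M_q$ for every visibility region $q$ neighbouring $s$. Then a set $G$ of vertices of $P$ is an optimal solution of the vertex guard problem (that is, $G$ covers $P$ and no set of vertices of smaller cardinality covers $P$) if and only if $G$ is a minimum set covering all VG-sinks (that is, $G$ covers every VG-sink and no set of vertices of smaller cardinality does). -/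

import Mathlib

namespace ArtGallery

/-- The Euclidean plane. -/
abbrev Plane := EuclideanSpace ℝ (Fin 2)

variable {n : ℕ}

/-- The closed polygonal chain through the vertices `p 0, …, p (n - 1)` is simple: it has at least
three vertices, they are distinct, consecutive edges meet only in their common vertex, and
non-consecutive edges are disjoint. (`finRotate n i` is `i + 1` modulo `n`.) -/
structure IsSimple (p : Polygon Plane n) : Prop where
  three_le : 3 ≤ n
  injective : Function.Injective p.vertices
  consecutive : ∀ i : Fin n,
    p.edgeSet ℝ i ∩ p.edgeSet ℝ (finRotate n i) = {p (finRotate n i)}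
  disjoint : ∀ i j : Fin n, i ≠ j → j ≠ finRotate n i → i ≠ finRotate n j →
    Disjoint (p.edgeSet ℝ i) (p.edgeSet ℝ j)

/-- The open inside of the chain: the points off the chain whose connected component in the
complement of the chain is bounded. -/
def inside (p : Polygon Plane n) : Set Plane :=
  {x | x ∉ p.boundary ℝ ∧
    Bornology.IsBounded (connectedComponentIn (p.boundary ℝ)ᶜ x)}

/-- The polygon as a closed region of the plane: the closure of its inside
(for a simple polygon this is the inside together with the chain). -/
def region (p : Polygon Plane n) : Set Plane :=
  closure (inside p)

/-- Two points are visible to each other in the polygon if every convex combination of them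
belongs to the polygon. -/
def Visible (p : Polygon Plane n) (x y : Plane) : Prop :=
  segment ℝ x y ⊆ region p

/-- The (indices of the) vertices that are visible from the point `x`. -/
def visibleVertices (p : Polygon Plane n) (x : Plane) : Set (Fin n) :=
  {i | Visible p (p i) x}

/-- A visibility region: a maximal connected subset of the polygon all of whose points are visible
from the same vertices. -/
def IsVisibilityRegion (p : Polygon Plane n) (R : Set Plane) : Prop :=
  Maximal (fun S : Set Plane => S ⊆ region p ∧ IsConnected S ∧
    ∀ x ∈ S, ∀ y ∈ S, visibleVertices p x = visibleVertices p y) R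

/-- The visibility set of `R`: the vertices that see (every point of) `R`. -/
def visibilitySet (p : Polygon Plane n) (R : Set Plane) : Set (Fin n) :=
  {i | ∀ x ∈ R, Visible p (p i) x}

/-- Two different visibility regions are neighbouring if they share an edge: a nondegenerate segment
that belongs to the boundary of both and that is made of points of these two regions.

The visibility regions partition the polygon, so the points of an edge belong to visibility regions
too; the second condition says that no third region separates the two along the edge. If no three
vertices are collinear, it holds for a piece of every segment in the common boundary; it matters
where one segment is a window of two vertices, seen from opposite sides, and is a visibility region
of its own: that region is then the neighbour of both sides. -/
def Neighbouring (p : Polygon Plane n) (R Q : Set Plane) : Prop :=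
  IsVisibilityRegion p R ∧ IsVisibilityRegion p Q ∧ R ≠ Q ∧
    ∃ a b : Plane, a ≠ b ∧ segment ℝ a b ⊆ frontier R ∩ frontier Q ∧ segment ℝ a b ⊆ R ∪ Q

/-- A sink for the vertex guard problem: a (two-dimensional) visibility region whose visibility set
is contained in the visibility set of every neighbouring visibility region. An isolated point at
which several windows cross, which has no edges, does not count as a sink. -/
def IsVGSink (p : Polygon Plane n) (s : Set Plane) : Prop :=
  IsVisibilityRegion p s ∧ (interior s).Nonempty ∧
    ∀ q : Set Plane, Neighbouring p s q → visibilitySet p s ⊆ visibilitySet p q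

/-- The set `G` of vertices covers `A`: every point of `A` is visible from some vertex in `G`. -/
def Covers (p : Polygon Plane n) (G : Finset (Fin n)) (A : Set Plane) : Prop :=
  ∀ x ∈ A, ∃ i ∈ G, Visible p (p i) x

/-- `G` covers every VG-sink. -/
def CoversSinks (p : Polygon Plane n) (G : Finset (Fin n)) : Prop :=
  ∀ s : Set Plane, IsVGSink p s → Covers p G s

/-- `G` is an optimal solution of the vertex guard problem: it covers the polygon, and no set of
vertices of smaller cardinality does. -/
def IsOptimalVertexGuardSet (p : Polygon Plane n) (G : Finset (Fin n)) : Prop :=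
  Covers p G (region p) ∧ ∀ H : Finset (Fin n), Covers p H (region p) → G.card ≤ H.card

/-- `G` is a set of vertices of minimum cardinality among those that cover all VG-sinks. -/
def IsMinimumSinkCover (p : Polygon Plane n) (G : Finset (Fin n)) : Prop :=
  CoversSinks p G ∧ ∀ H : Finset (Fin n), CoversSinks p H → G.card ≤ H.card

end ArtGallery

/-! The theorem says that a set of vertices covers the polygon as soon as it covers all VG-sinks;
the two minimisation problems then have the same feasible sets, hence the same optima.

The set of points visible from a fixed vertex is closed, so the map `visibleVertices p` is upper
semicontinuous: near a point `x`, no vertices are visible but those that are visible from `x`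
(`eventually_visibleVertices_subset`). As the polygon is the closure of its inside, below every
point `x` of the polygon there is an inside point `y` at which `visibleVertices p y` is minimal
among all values taken on the polygon, with `visibleVertices p y ⊆ visibleVertices p x`
(`exists_minimal_visibleVertices`). Semicontinuity and minimality make `visibleVertices p` constant
near `y`, so the visibility region `R` of `y` has interior points. Moreover `R` is a sink: an edge
shared with a neighbouring region `Q` has a point that lies in one of the regions and in the closure
of the other. If it lies in `Q`, semicontinuity gives `visibilitySet p R ⊆ visibilitySet p Q`; if it
lies in `R`, semicontinuity gives the reverse inclusion, which minimality turns into an equality.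
A guard that sees a point of `R` therefore belongs to `visibleVertices p y` and so sees `x`. -/

namespace ArtGallery

open Set Topology

/-! ### Topology of the region and of the visible sets -/

theorem isClosed_boundary (p : Polygon Plane n) : IsClosed (p.boundary ℝ) := by
  refine isClosed_iUnion_of_finite fun i => ?_
  rw [Polygon.edgeSet_eq_image_edgePath]
  exact (isCompact_Icc.image (p.edgePath ℝ i).continuous_of_finiteDimensional).isClosed

theorem isOpen_inside (p : Polygon Plane n) : IsOpen (inside p) := by
  have hU : IsOpen (p.boundary ℝ)ᶜ := (isClosed_boundary p).isOpen_compl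
  rw [isOpen_iff_mem_nhds]
  rintro x ⟨hx, hb⟩
  filter_upwards [hU.connectedComponentIn.mem_nhds (mem_connectedComponentIn hx)] with y hy
  exact ⟨connectedComponentIn_subset _ _ hy, connectedComponentIn_eq hy ▸ hb⟩

theorem isClosed_setOf_visible (p : Polygon Plane n) (v : Plane) :
    IsClosed {x | Visible p v x} := by
  have h : {x | Visible p v x} =
      ⋂ t ∈ Icc (0 : ℝ) 1, (fun x => v + t • (x - v)) ⁻¹' region p := by
    ext x
    simp only [Visible, segment_eq_image', image_subset_iff, mem_ofPred_eq, mem_iInter]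
    rfl
  rw [h]
  exact isClosed_biInter fun t _ => isClosed_closure.preimage (by fun_prop)

/-- Upper semicontinuity of `visibleVertices`. -/
theorem eventually_visibleVertices_subset (p : Polygon Plane n) (x : Plane) :
    ∀ᶠ y in 𝓝 x, visibleVertices p y ⊆ visibleVertices p x := by
  have h : ∀ i : Fin n, ∀ᶠ y in 𝓝 x, Visible p (p i) y → Visible p (p i) x := by
    intro i
    by_cases hi : Visible p (p i) x
    · exact Filter.Eventually.of_forall fun _ _ => hi
    · filter_upwards [(isClosed_setOf_visible p (p i)).isOpen_compl.mem_nhds hi] with y hy hy'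
      exact absurd hy' hy
  filter_upwards [Filter.eventually_all.2 h] with y hy i hi using hy i hi

/-- Below every point of the polygon there is an inside point whose set of visible vertices is
minimal among those of all points of the polygon. -/
theorem exists_minimal_visibleVertices (p : Polygon Plane n) {x : Plane} (hx : x ∈ region p) :
    ∃ y ∈ inside p, visibleVertices p y ⊆ visibleVertices p x ∧
      ∀ z ∈ region p, visibleVertices p z ⊆ visibleVertices p y →
        visibleVertices p z = visibleVertices p y := by
  have approx : ∀ z ∈ region p, ∃ y ∈ inside p, visibleVertices p y ⊆ visibleVertices p z := by
    intro z hz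
    obtain ⟨y, hyz, hy⟩ := mem_closure_iff_nhds.1 hz _ (eventually_visibleVertices_subset p z)
    exact ⟨y, hy, hyz⟩
  obtain ⟨y₀, hy₀, hle₀⟩ := approx x hx
  obtain ⟨_, hle, ⟨y, hy, rfl⟩, hmin⟩ := exists_minimal_le_of_wellFoundedLT
    (fun S => ∃ y ∈ inside p, visibleVertices p y = S) _ ⟨y₀, hy₀, rfl⟩
  refine ⟨y, hy, hle.trans hle₀, fun z hz hzy => hzy.antisymm ?_⟩
  obtain ⟨w, hw, hwz⟩ := approx z hz
  exact (hmin ⟨w, hw, rfl⟩ (hwz.trans hzy)).trans hwz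

/-! ### Visibility regions -/

theorem IsVisibilityRegion.visibilitySet_eq {p : Polygon Plane n} {R : Set Plane}
    (hR : IsVisibilityRegion p R) {x : Plane} (hx : x ∈ R) :
    visibilitySet p R = visibleVertices p x := by
  ext i
  refine ⟨fun h => h x hx, fun h y hy => ?_⟩
  have hi : i ∈ visibleVertices p y := hR.prop.2.2 x hx y hy ▸ h
  exact hi

theorem visibilitySet_subset_of_mem_closure (p : Polygon Plane n) {R : Set Plane} {x : Plane}
    (hx : x ∈ closure R) :
    visibilitySet p R ⊆ visibleVertices p x := fun i hi =>
  closure_minimal (fun _ hy => hi _ hy) (isClosed_setOf_visible p (p i)) hx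

/-- The visibility region of a point, as a connected component of the set of points of the polygon
that see the same vertices. -/
theorem isVisibilityRegion_connectedComponentIn {p : Polygon Plane n} {y : Plane}
    (hy : y ∈ region p) :
    IsVisibilityRegion p
      (connectedComponentIn {z ∈ region p | visibleVertices p z = visibleVertices p y} y) := by
  have hyF : y ∈ {z ∈ region p | visibleVertices p z = visibleVertices p y} := ⟨hy, rfl⟩
  have hsub := connectedComponentIn_subset
    {z ∈ region p | visibleVertices p z = visibleVertices p y} y
  refine ⟨⟨fun z hz => (hsub hz).1, isConnected_connectedComponentIn_iff.2 hyF,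
    fun a ha b hb => (hsub ha).2.trans (hsub hb).2.symm⟩, ?_⟩
  rintro S ⟨hS, hconn, hconst⟩ hle
  have hyS : y ∈ S := hle (mem_connectedComponentIn hyF)
  exact hconn.isPreconnected.subset_connectedComponentIn hyS
    fun z hz => ⟨hS hz, hconst z hz y hyS⟩

/-! ### Sinks -/

/-- A visibility region with minimal set of visible vertices is a sink. -/
theorem isVGSink_connectedComponentIn {p : Polygon Plane n} {y : Plane} (hy : y ∈ inside p)
    (hmin : ∀ z ∈ region p, visibleVertices p z ⊆ visibleVertices p y →
      visibleVertices p z = visibleVertices p y) :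
    IsVGSink p
      (connectedComponentIn {z ∈ region p | visibleVertices p z = visibleVertices p y} y) := by
  have hyr : y ∈ region p := subset_closure hy
  have hR := isVisibilityRegion_connectedComponentIn hyr
  have hyR : y ∈ connectedComponentIn
      {z ∈ region p | visibleVertices p z = visibleVertices p y} y :=
    mem_connectedComponentIn ⟨hyr, rfl⟩
  refine ⟨hR, ⟨y, ?_⟩, ?_⟩
  · have hnhds : {z ∈ region p | visibleVertices p z = visibleVertices p y} ∈ 𝓝 y := by
      filter_upwards [(isOpen_inside p).mem_nhds hy, eventually_visibleVertices_subset p y]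
        with z hz hzy
      exact ⟨subset_closure hz, hmin z (subset_closure hz) hzy⟩
    exact mem_interior_iff_mem_nhds.2 (connectedComponentIn_mem_nhds hnhds)
  · rintro Q ⟨-, hQ, -, a, b, -, hfr, hun⟩
    have ha := left_mem_segment ℝ a b
    obtain ⟨haR, haQ⟩ := hfr ha
    rcases hun ha with h | h
    -- The shared point lies in the region itself: here minimality is needed.
    · have hQR := visibilitySet_subset_of_mem_closure p (frontier_subset_closure haQ)
      rw [← hR.visibilitySet_eq h, hR.visibilitySet_eq hyR] at hQR
      obtain ⟨z, hz⟩ := hQ.prop.2.1.nonempty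
      rw [hQ.visibilitySet_eq hz] at hQR ⊢
      rw [hR.visibilitySet_eq hyR, hmin z (hQ.prop.1 hz) hQR]
    · rw [hQ.visibilitySet_eq h]
      exact visibilitySet_subset_of_mem_closure p (frontier_subset_closure haR)

theorem exists_isVGSink_visibilitySet_subset (p : Polygon Plane n) {x : Plane}
    (hx : x ∈ region p) : ∃ s, IsVGSink p s ∧ visibilitySet p s ⊆ visibleVertices p x := by
  obtain ⟨y, hy, hyx, hmin⟩ := exists_minimal_visibleVertices p hx
  have hs := isVGSink_connectedComponentIn hy hmin
  refine ⟨_, hs, ?_⟩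
  rwa [hs.1.visibilitySet_eq (mem_connectedComponentIn ⟨subset_closure hy, rfl⟩)]

theorem covers_region_iff_coversSinks (p : Polygon Plane n) (G : Finset (Fin n)) :
    Covers p G (region p) ↔ CoversSinks p G := by
  refine ⟨fun h s hs x hx => h x (hs.1.prop.1 hx), fun h x hx => ?_⟩
  obtain ⟨s, hs, hsx⟩ := exists_isVGSink_visibilitySet_subset p hx
  obtain ⟨z, hz⟩ := hs.1.prop.2.1.nonempty
  obtain ⟨i, hiG, hi⟩ := h s hs z hz
  rw [hs.1.visibilitySet_eq hz] at hsx
  exact ⟨i, hiG, hsx hi⟩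

end ArtGallery

theorem lemma2p1 (n : ℕ) (p : Polygon ArtGallery.Plane n) (hp : ArtGallery.IsSimple p)
    (G : Finset (Fin n)) :
    ArtGallery.IsOptimalVertexGuardSet p G ↔ ArtGallery.IsMinimumSinkCover p G := by
  simp only [ArtGallery.IsOptimalVertexGuardSet, ArtGallery.IsMinimumSinkCover,
    ArtGallery.covers_region_iff_coversSinks]
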